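/- Let $M$ be a compact smooth manifold without boundary, of dimension $n\ge 0$, with a smooth Riemannian metric $g$, and let $\mathrm{Ric}$ denote the Ricci tensor of $g$. Suppose that $g$ is a steady or expanding gradient Ricci soliton, that is, there are a smooth function $u : M\to\mathbb R$ (the potential) and a real constant $\lambda\le 0$ ($\lambda=0$: steady; $\lambda<0$: expanding) such that $$\lambda g-\mathrm{Ric}=\nabla\nabla u,$$ where $\nabla\nabla u$ is the Hessian of $u$ with respect to the Levi-Civita connection of $g$. Then $g$ is an Einstein metric, i.e. there is a constant $c\in\mathbb R$ with $\mathrm{Ric}=c\,g$ on $M$; moreover the potential $u$ is constant on every connected component of $M$. -/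

import Mathlib

open scoped Manifold ContDiff

noncomputable section

namespace RicciSoliton

/-! ### Riemannian geometry in local coordinates

Here `G y` is the matrix `(g_ij(y))` of a Riemannian metric on (an open subset of) `ℝⁿ`. -/

section Coordinates

variable {n : ℕ}

/-- The partial derivative `∂_i f` at `y`. -/
def pderiv (i : Fin n) (f : EuclideanSpace ℝ (Fin n) → ℝ) (y : EuclideanSpace ℝ (Fin n)) : ℝ :=
  fderiv ℝ f y (EuclideanSpace.single i 1)

/-- The Christoffel symbol of the Levi-Civita connection,
`Γ^k_ij = (1/2) ∑_l g^{kl} (∂_i g_jl + ∂_j g_il - ∂_l g_ij)`. -/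
def christoffel (G : EuclideanSpace ℝ (Fin n) → Matrix (Fin n) (Fin n) ℝ)
    (k i j : Fin n) (y : EuclideanSpace ℝ (Fin n)) : ℝ :=
  (1 / 2 : ℝ) * ∑ l, (G y)⁻¹ k l *
    (pderiv i (fun z => G z j l) y + pderiv j (fun z => G z i l) y - pderiv l (fun z => G z i j) y)

/-- The component `R^l_{kij}` of the Riemann curvature tensor, that is, the `∂_l`-component of
`R(∂_i, ∂_j) ∂_k = ∇_i ∇_j ∂_k - ∇_j ∇_i ∂_k`. -/
def riemann (G : EuclideanSpace ℝ (Fin n) → Matrix (Fin n) (Fin n) ℝ)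
    (l k i j : Fin n) (y : EuclideanSpace ℝ (Fin n)) : ℝ :=
  pderiv i (christoffel G l j k) y - pderiv j (christoffel G l i k) y +
    ∑ m, (christoffel G l i m y * christoffel G m j k y -
      christoffel G l j m y * christoffel G m i k y)

/-- The component `R_jk` of the Ricci tensor: the trace of `X ↦ R(X, ∂_j) ∂_k`. -/
def ricci (G : EuclideanSpace ℝ (Fin n) → Matrix (Fin n) (Fin n) ℝ)
    (j k : Fin n) (y : EuclideanSpace ℝ (Fin n)) : ℝ :=
  ∑ i, riemann G i k i j y

/-- The component `∇_i ∇_j f = ∂_i ∂_j f - ∑_k Γ^k_ij ∂_k f` of the Hessian of a function. -/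
def hessian (G : EuclideanSpace ℝ (Fin n) → Matrix (Fin n) (Fin n) ℝ)
    (f : EuclideanSpace ℝ (Fin n) → ℝ) (i j : Fin n) (y : EuclideanSpace ℝ (Fin n)) : ℝ :=
  pderiv i (pderiv j f) y - ∑ k, christoffel G k i j y * pderiv k f y

end Coordinates

/-! ### Riemannian manifolds -/

section Manifolds

variable {n : ℕ} {M : Type*} [TopologicalSpace M] [ChartedSpace (EuclideanSpace ℝ (Fin n)) M]
  [IsManifold (𝓡 n) ∞ M]

/-- The coefficient matrix `g_ij = g(∂_i, ∂_j)` of a Riemannian metric `g` in the chart `e`, as a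
function of the coordinates; `∂_i` is the image of the `i`-th standard basis vector under the
derivative of `e⁻¹`. It is meaningful on `e.target`. -/
def metricInChart
    (g : Bundle.ContMDiffRiemannianMetric (𝓡 n) ∞ (EuclideanSpace ℝ (Fin n))
      (fun x : M => TangentSpace (𝓡 n) x))
    (e : OpenPartialHomeomorph M (EuclideanSpace ℝ (Fin n)))
    (y : EuclideanSpace ℝ (Fin n)) : Matrix (Fin n) (Fin n) ℝ :=
  Matrix.of fun i j => g.inner (e.symm y)
    (mfderiv (𝓡 n) (𝓡 n) e.symm y (EuclideanSpace.single i (1 : ℝ)))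
    (mfderiv (𝓡 n) (𝓡 n) e.symm y (EuclideanSpace.single j (1 : ℝ)))

/-- `g` is a gradient Ricci soliton with potential `u` and homothetic constant `lam`: `u` is smooth
and `lam * g_ij - R_ij = ∇_i ∇_j u` holds throughout every smooth chart of `M`. The soliton is
shrinking, steady or expanding according as `lam > 0`, `lam = 0` or `lam < 0`. -/
structure IsGradientRicciSoliton
    (g : Bundle.ContMDiffRiemannianMetric (𝓡 n) ∞ (EuclideanSpace ℝ (Fin n))
      (fun x : M => TangentSpace (𝓡 n) x))
    (u : M → ℝ) (lam : ℝ) : Prop where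
  smooth : ContMDiff (𝓡 n) 𝓘(ℝ, ℝ) ∞ u
  equation : ∀ e ∈ IsManifold.maximalAtlas (𝓡 n) ∞ M, ∀ y ∈ e.target, ∀ i j : Fin n,
    lam * metricInChart g e y i j - ricci (metricInChart g e) i j y =
      hessian (metricInChart g e) (fun z => u (e.symm z)) i j y

/-- `g` is an Einstein metric: `Ric = c g` for a real constant `c`. -/
def IsEinstein
    (g : Bundle.ContMDiffRiemannianMetric (𝓡 n) ∞ (EuclideanSpace ℝ (Fin n))
      (fun x : M => TangentSpace (𝓡 n) x)) : Prop :=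
  ∃ c : ℝ, ∀ e ∈ IsManifold.maximalAtlas (𝓡 n) ∞ M, ∀ y ∈ e.target, ∀ i j : Fin n,
    ricci (metricInChart g e) i j y = c * metricInChart g e y i j

end Manifolds

end RicciSoliton

end

/-! The proof applies the maximum principle to the Bochner formula for the potential. Taking the
divergence of the soliton equation and using the contracted Bianchi identity gives `∇Δu = -2
Ric(∇u)`. Bochner's formula then becomes `Δ|∇u|² = 2|∇∇u|² - 2 Ric(∇u, ∇u)`, and by the soliton
equation this equals `2|∇∇u|² - 2λ|∇u|² + 2 ∇∇u(∇u, ∇u)` (`IsNormalAt.bochner`).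

When `λ = 0`, a maximum of `|∇u|²` says nothing about `∇u` itself, so one maximizes `|∇u|² - εu`
with `ε > 0`. At a maximum, `2∇∇u(∇u) = ε∇u`, so the last term becomes `ε|∇u|²`. Since `Δ|∇u|² ≤
εΔu` and `λ ≤ 0`, completing squares in the diagonal of the Hessian yields `|∇u|² ≤ nε/8` there
(`IsNormalAt.gradSq_le_of_isLocalMax`). Compactness spreads this to a bound of order `ε` on all of
`M`, and `ε → 0` gives `∇u = 0`. So `u` is locally constant, its Hessian vanishes, and `Ric = λg`.

All curvature computations take place at one point of a chart where the metric is the identity to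
first order (`exists_normal_chart`). The soliton equation is assumed in every chart of the maximal
atlas, so it can be used there directly, without a transformation law for Ricci or the Hessian. Only
`|∇u|²` is compared between points in different charts, and it alone is given a chart-free form,
`gradNormSq`. -/

open Filter Topology in
theorem IsLocalMax.deriv_deriv_nonpos {f : ℝ → ℝ} {x : ℝ} (hf : IsLocalMax f x)
    (hc : ContinuousAt f x) : deriv (deriv f) x ≤ 0 := by
  by_contra! h
  -- A positive second derivative would make `x` a local minimum as well, so `f` would be constant
  -- near `x` and its second derivative zero.
  have hmin := isLocalMin_of_deriv_deriv_pos h hf.deriv_eq_zero hc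
  have hconst : f =ᶠ[𝓝 x] fun _ => f x := by
    filter_upwards [hf, hmin] with y h1 h2 using le_antisymm h1 h2
  have h1 : deriv f =ᶠ[𝓝 x] fun _ => 0 := by
    filter_upwards [hconst.eventuallyEq_nhds] with y hy
    simp [hy.deriv_eq]
  simp [h1.deriv_eq] at h

namespace RicciSoliton

open Filter Topology

/-! ### Calculus of partial derivatives. -/

section PartialDerivatives

variable {n : ℕ} {f g : EuclideanSpace ℝ (Fin n) → ℝ} {z : EuclideanSpace ℝ (Fin n)}

theorem pderiv_congr (h : f =ᶠ[𝓝 z] g) (i : Fin n) : pderiv i f z = pderiv i g z := by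
  simp [pderiv, h.fderiv_eq]

theorem pderiv_eventuallyEq (h : f =ᶠ[𝓝 z] g) (i : Fin n) : pderiv i f =ᶠ[𝓝 z] pderiv i g := by
  filter_upwards [h.eventuallyEq_nhds] with y hy using pderiv_congr hy i

theorem contDiffAt_pderiv (hf : ContDiffAt ℝ ∞ f z) (i : Fin n) :
    ContDiffAt ℝ ∞ (pderiv i f) z :=
  (hf.fderiv_right (m := ∞) (by simp)).clm_apply contDiffAt_const

theorem eventually_differentiableAt (hf : ContDiffAt ℝ ∞ f z) :
    ∀ᶠ y in 𝓝 z, DifferentiableAt ℝ f y := by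
  have h1 : ContDiffAt ℝ 1 f z := hf.of_le (by exact_mod_cast le_top)
  filter_upwards [h1.eventually (by simp)] with y hy using hy.differentiableAt (by simp)

theorem differentiableAt_of_smooth (hf : ContDiffAt ℝ ∞ f z) : DifferentiableAt ℝ f z :=
  hf.differentiableAt (by simp)

@[simp] theorem pderiv_const (c : ℝ) (i : Fin n) :
    pderiv i (fun _ : EuclideanSpace ℝ (Fin n) => c) z = 0 := by
  simp [pderiv]

theorem pderiv_add (hf : DifferentiableAt ℝ f z) (hg : DifferentiableAt ℝ g z) (i : Fin n) :
    pderiv i (fun y => f y + g y) z = pderiv i f z + pderiv i g z := by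
  simp [pderiv, fderiv_fun_add hf hg]

theorem pderiv_sub (hf : DifferentiableAt ℝ f z) (hg : DifferentiableAt ℝ g z) (i : Fin n) :
    pderiv i (fun y => f y - g y) z = pderiv i f z - pderiv i g z := by
  simp [pderiv, fderiv_fun_sub hf hg]

theorem pderiv_const_mul (hf : DifferentiableAt ℝ f z) (c : ℝ) (i : Fin n) :
    pderiv i (fun y => c * f y) z = c * pderiv i f z := by
  simp [pderiv, fderiv_const_mul hf]

theorem pderiv_mul (hf : DifferentiableAt ℝ f z) (hg : DifferentiableAt ℝ g z) (i : Fin n) :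
    pderiv i (fun y => f y * g y) z = pderiv i f z * g z + f z * pderiv i g z := by
  simp [pderiv, fderiv_fun_mul hf hg]
  ring

theorem pderiv_sum {ι : Type*} {s : Finset ι} {F : ι → EuclideanSpace ℝ (Fin n) → ℝ}
    (hF : ∀ l ∈ s, DifferentiableAt ℝ (F l) z) (i : Fin n) :
    pderiv i (fun y => ∑ l ∈ s, F l y) z = ∑ l ∈ s, pderiv i (F l) z := by
  simp [pderiv, fderiv_fun_sum hF]

theorem pderiv_pderiv_sub (hf : ContDiffAt ℝ ∞ f z) (hg : ContDiffAt ℝ ∞ g z) (i j : Fin n) :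
    pderiv i (pderiv j fun y => f y - g y) z = pderiv i (pderiv j f) z - pderiv i (pderiv j g) z := by
  rw [pderiv_congr (g := fun y => pderiv j f y - pderiv j g y) _ i, pderiv_sub]
  · exact differentiableAt_of_smooth (contDiffAt_pderiv hf j)
  · exact differentiableAt_of_smooth (contDiffAt_pderiv hg j)
  · filter_upwards [eventually_differentiableAt hf, eventually_differentiableAt hg] with y h1 h2
      using pderiv_sub h1 h2 j

theorem pderiv_pderiv_add (hf : ContDiffAt ℝ ∞ f z) (hg : ContDiffAt ℝ ∞ g z) (i j : Fin n) :
    pderiv i (pderiv j fun y => f y + g y) z = pderiv i (pderiv j f) z + pderiv i (pderiv j g) z := by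
  rw [pderiv_congr (g := fun y => pderiv j f y + pderiv j g y) _ i, pderiv_add]
  · exact differentiableAt_of_smooth (contDiffAt_pderiv hf j)
  · exact differentiableAt_of_smooth (contDiffAt_pderiv hg j)
  · filter_upwards [eventually_differentiableAt hf, eventually_differentiableAt hg] with y h1 h2
      using pderiv_add h1 h2 j

theorem pderiv_pderiv_const_mul (hf : ContDiffAt ℝ ∞ f z) (c : ℝ) (i j : Fin n) :
    pderiv i (pderiv j fun y => c * f y) z = c * pderiv i (pderiv j f) z := by
  rw [pderiv_congr (g := fun y => c * pderiv j f y) _ i, pderiv_const_mul]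
  · exact differentiableAt_of_smooth (contDiffAt_pderiv hf j)
  · filter_upwards [eventually_differentiableAt hf] with y h1 using pderiv_const_mul h1 c j

theorem pderiv_pderiv_sum {ι : Type*} {s : Finset ι} {F : ι → EuclideanSpace ℝ (Fin n) → ℝ}
    (hF : ∀ l ∈ s, ContDiffAt ℝ ∞ (F l) z) (i j : Fin n) :
    pderiv i (pderiv j fun y => ∑ l ∈ s, F l y) z = ∑ l ∈ s, pderiv i (pderiv j (F l)) z := by
  rw [pderiv_congr (g := fun y => ∑ l ∈ s, pderiv j (F l) y) _ i, pderiv_sum]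
  · exact fun l hl => differentiableAt_of_smooth (contDiffAt_pderiv (hF l hl) j)
  · have : ∀ᶠ y in 𝓝 z, ∀ l ∈ s, DifferentiableAt ℝ (F l) y :=
      (eventually_all_finset s).2 fun l hl => eventually_differentiableAt (hF l hl)
    filter_upwards [this] with y hy using pderiv_sum hy j

theorem pderiv_pderiv_mul (hf : ContDiffAt ℝ ∞ f z) (hg : ContDiffAt ℝ ∞ g z) (i j : Fin n) :
    pderiv i (pderiv j fun y => f y * g y) z =
      pderiv i (pderiv j f) z * g z + pderiv j f z * pderiv i g z +
        (pderiv i f z * pderiv j g z + f z * pderiv i (pderiv j g) z) := by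
  have hf' := contDiffAt_pderiv hf j
  have hg' := contDiffAt_pderiv hg j
  rw [pderiv_congr (g := fun y => pderiv j f y * g y + f y * pderiv j g y) _ i, pderiv_add,
    pderiv_mul, pderiv_mul]
  · exact differentiableAt_of_smooth hf
  · exact differentiableAt_of_smooth hg'
  · exact differentiableAt_of_smooth hf'
  · exact differentiableAt_of_smooth hg
  · exact differentiableAt_of_smooth (hf'.mul hg)
  · exact differentiableAt_of_smooth (hf.mul hg')
  · filter_upwards [eventually_differentiableAt hf, eventually_differentiableAt hg] with y h1 h2
      using pderiv_mul h1 h2 j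

theorem pderiv_comm (hf : ContDiffAt ℝ 2 f z) (i j : Fin n) :
    pderiv i (pderiv j f) z = pderiv j (pderiv i f) z := by
  have hsymm : IsSymmSndFDerivAt ℝ f z := hf.isSymmSndFDerivAt (by simp)
  have hd : DifferentiableAt ℝ (fderiv ℝ f) z :=
    (hf.fderiv_right (m := 1) (by norm_num)).differentiableAt (by simp)
  have key : ∀ a b : Fin n, pderiv a (pderiv b f) z =
      fderiv ℝ (fderiv ℝ f) z (EuclideanSpace.single a 1) (EuclideanSpace.single b 1) := by
    intro a b
    unfold pderiv
    rw [fderiv_clm_apply hd (differentiableAt_const _)]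
    simp
  rw [key, key, hsymm.eq]

theorem pderiv_comm_eventuallyEq (hf : ContDiffAt ℝ ∞ f z) (i j : Fin n) :
    pderiv i (pderiv j f) =ᶠ[𝓝 z] pderiv j (pderiv i f) := by
  have h2 : ContDiffAt ℝ 2 f z := contDiffAt_infty.1 hf 2
  filter_upwards [h2.eventually (by simp)] with y hy using pderiv_comm hy i j

theorem pderiv_comm_of_smooth (hf : ContDiffAt ℝ ∞ f z) (i j : Fin n) :
    pderiv i (pderiv j f) z = pderiv j (pderiv i f) z :=
  (pderiv_comm_eventuallyEq hf i j).self_of_nhds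

theorem pderiv_eq_zero_of_isLocalMax (hf : IsLocalMax f z) (i : Fin n) : pderiv i f z = 0 := by
  simp [pderiv, hf.fderiv_eq_zero]

/-- Restriction to the coordinate line through `z` reduces this to the one-variable second
derivative test. -/
theorem pderiv_pderiv_nonpos_of_isLocalMax (hf : IsLocalMax f z) (hs : ContDiffAt ℝ ∞ f z)
    (i : Fin n) : pderiv i (pderiv i f) z ≤ 0 := by
  set c : ℝ → EuclideanSpace ℝ (Fin n) := fun t => z + t • EuclideanSpace.single i 1 with hc
  have hc0 : c 0 = z := by simp [hc]
  have hcd : ∀ t, HasDerivAt c (EuclideanSpace.single i 1) t := fun t => by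
    have h := ((hasDerivAt_id t).smul_const (EuclideanSpace.single i (1 : ℝ))).const_add z
    rwa [one_smul] at h
  have hct : Tendsto c (𝓝 0) (𝓝 z) := hc0 ▸ (hcd 0).continuousAt.tendsto
  have hchain : ∀ F : EuclideanSpace ℝ (Fin n) → ℝ, ContDiffAt ℝ ∞ F z →
      deriv (fun t => F (c t)) =ᶠ[𝓝 0] fun t => pderiv i F (c t) := by
    intro F hF
    filter_upwards [hct.eventually (eventually_differentiableAt hF)] with t ht
    exact (ht.hasFDerivAt.comp_hasDerivAt t (hcd t)).deriv
  have hmax : IsLocalMax (fun t => f (c t)) 0 := by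
    filter_upwards [hct.eventually hf] with t ht
    simpa [hc0] using ht
  have hcont : ContinuousAt (fun t => f (c t)) 0 :=
    ContinuousAt.comp (by simpa [hc0] using hs.continuousAt) (hcd 0).continuousAt
  have := hmax.deriv_deriv_nonpos hcont
  rw [(hchain f hs).deriv_eq, (hchain _ (contDiffAt_pderiv hs i)).self_of_nhds] at this
  simpa only [hc0] using this

end PartialDerivatives

/-! ### Curvature at a point where the metric is Euclidean to first order. -/

section NormalCoordinates

variable {n : ℕ} {G : EuclideanSpace ℝ (Fin n) → Matrix (Fin n) (Fin n) ℝ}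
  {z : EuclideanSpace ℝ (Fin n)}

theorem contDiffAt_det {m : ℕ} {A : EuclideanSpace ℝ (Fin n) → Matrix (Fin m) (Fin m) ℝ}
    (hA : ∀ i j, ContDiffAt ℝ ∞ (fun y => A y i j) z) :
    ContDiffAt ℝ ∞ (fun y => (A y).det) z := by
  simp only [Matrix.det_apply']
  exact ContDiffAt.sum fun σ _ => contDiffAt_const.mul (contDiffAt_prod fun i _ => hA _ _)

theorem contDiffAt_inv_apply (hG : ∀ i j, ContDiffAt ℝ ∞ (fun y => G y i j) z)
    (hdet : (G z).det ≠ 0) (i j : Fin n) : ContDiffAt ℝ ∞ (fun y => (G y)⁻¹ i j) z := by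
  have h : ∀ y, (G y)⁻¹ i j = (G y).det⁻¹ * (G y).adjugate i j := fun y => by
    simp [Matrix.inv_def]
  simp only [h]
  refine (contDiffAt_det hG |>.inv hdet).mul ?_
  simp only [Matrix.adjugate_apply]
  refine contDiffAt_det fun a b => ?_
  by_cases ha : a = j
  · subst ha
    simpa using contDiffAt_const
  · simpa [Matrix.updateRow_ne ha] using hG a b

/-- `G` is a smooth symmetric matrix field which is the identity to first order at `z`. -/
structure IsNormalAt (G : EuclideanSpace ℝ (Fin n) → Matrix (Fin n) (Fin n) ℝ)
    (z : EuclideanSpace ℝ (Fin n)) : Prop where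
  smooth : ∀ i j, ContDiffAt ℝ ∞ (fun y => G y i j) z
  symm : ∀ y i j, G y i j = G y j i
  eq_one : G z = 1
  pderiv_eq_zero : ∀ k i j, pderiv k (fun y => G y i j) z = 0

namespace IsNormalAt

variable (h : IsNormalAt G z)
include h

theorem smooth_inv (i j : Fin n) : ContDiffAt ℝ ∞ (fun y => (G y)⁻¹ i j) z :=
  contDiffAt_inv_apply h.smooth (by simp [h.eq_one]) i j

theorem eventually_mul_inv (i j : Fin n) :
    (fun y => ∑ k, G y i k * (G y)⁻¹ k j) =ᶠ[𝓝 z]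
      fun _ => (1 : Matrix (Fin n) (Fin n) ℝ) i j := by
  have hdet : ∀ᶠ y in 𝓝 z, (G y).det ≠ 0 :=
    (contDiffAt_det h.smooth).continuousAt.eventually_ne (by simp [h.eq_one])
  filter_upwards [hdet] with y hy
  rw [← Matrix.mul_apply, Matrix.mul_nonsing_inv _ (isUnit_iff_ne_zero.2 hy)]

theorem pderiv_inv (a i j : Fin n) : pderiv a (fun y => (G y)⁻¹ i j) z = 0 := by
  have h1 := pderiv_congr (h.eventually_mul_inv i j) a
  rw [pderiv_const, pderiv_sum fun k _ => differentiableAt_of_smooth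
    ((h.smooth i k).mul (h.smooth_inv k j))] at h1
  simp only [pderiv_mul (differentiableAt_of_smooth (h.smooth _ _))
    (differentiableAt_of_smooth (h.smooth_inv _ _)), h.pderiv_eq_zero, h.eq_one] at h1
  simpa [Matrix.one_apply] using h1

/-- Differentiate `G G⁻¹ = 1` twice; the cross terms carry first derivatives of `G`, which vanish at
`z`. -/
theorem pderiv_pderiv_inv (a b i j : Fin n) :
    pderiv a (pderiv b fun y => (G y)⁻¹ i j) z = -pderiv a (pderiv b fun y => G y i j) z := by
  have h1 := pderiv_congr (pderiv_eventuallyEq (h.eventually_mul_inv i j) b) a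
  rw [pderiv_pderiv_sum fun k _ => (h.smooth i k).mul (h.smooth_inv k j)] at h1
  simp only [pderiv_pderiv_mul (h.smooth _ _) (h.smooth_inv _ _), h.pderiv_eq_zero,
    h.pderiv_inv, h.eq_one] at h1
  have h2 : pderiv b (fun _ : EuclideanSpace ℝ (Fin n) => (1 : Matrix (Fin n) (Fin n) ℝ) i j)
      = fun _ => 0 := by
    ext y; simp
  rw [h2, pderiv_const] at h1
  simp [Matrix.one_apply, Finset.sum_add_distrib] at h1
  linarith

end IsNormalAt

/-- The first-kind combination `∂_i g_jl + ∂_j g_il - ∂_l g_ij`, i.e. twice the Christoffel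
symbol of the first kind. -/
noncomputable def christoffelLower (G : EuclideanSpace ℝ (Fin n) → Matrix (Fin n) (Fin n) ℝ) (l i j : Fin n)
    (y : EuclideanSpace ℝ (Fin n)) : ℝ :=
  pderiv i (fun z => G z j l) y + pderiv j (fun z => G z i l) y - pderiv l (fun z => G z i j) y

namespace IsNormalAt

variable (h : IsNormalAt G z)
include h

theorem smooth_christoffelLower (l i j : Fin n) :
    ContDiffAt ℝ ∞ (christoffelLower G l i j) z :=
  ((contDiffAt_pderiv (h.smooth _ _) _).add (contDiffAt_pderiv (h.smooth _ _) _)).sub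
    (contDiffAt_pderiv (h.smooth _ _) _)

theorem smooth_christoffel (l i j : Fin n) : ContDiffAt ℝ ∞ (christoffel G l i j) z :=
  contDiffAt_const.mul (ContDiffAt.sum fun k _ =>
    (h.smooth_inv l k).mul (h.smooth_christoffelLower k i j))

theorem christoffelLower_eq_zero (l i j : Fin n) : christoffelLower G l i j z = 0 := by
  simp [christoffelLower, h.pderiv_eq_zero]

theorem christoffel_eq_zero (l i j : Fin n) : christoffel G l i j z = 0 := by
  simp [christoffel, h.pderiv_eq_zero]

theorem pderiv_christoffel (a l i j : Fin n) :
    pderiv a (christoffel G l i j) z = 1 / 2 *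
      (pderiv a (pderiv i fun y => G y j l) z + pderiv a (pderiv j fun y => G y i l) z -
        pderiv a (pderiv l fun y => G y i j) z) := by
  have h1 : pderiv a (christoffel G l i j) z =
      pderiv a (fun y => 1 / 2 * ∑ k, (G y)⁻¹ l k * christoffelLower G k i j y) z := rfl
  have hs := fun k => (h.smooth_inv l k).mul (h.smooth_christoffelLower k i j)
  rw [h1, pderiv_const_mul (differentiableAt_of_smooth (ContDiffAt.sum fun k _ => hs k)),
    pderiv_sum fun k _ => differentiableAt_of_smooth (hs k)]
  simp only [pderiv_mul (differentiableAt_of_smooth (h.smooth_inv _ _))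
    (differentiableAt_of_smooth (h.smooth_christoffelLower _ _ _)), h.pderiv_inv, h.eq_one,
    h.christoffelLower_eq_zero]
  have h2 := contDiffAt_pderiv (h.smooth j l) i
  have h3 := contDiffAt_pderiv (h.smooth i l) j
  have h4 := contDiffAt_pderiv (h.smooth i j) l
  have h5 : pderiv a (christoffelLower G l i j) z =
      pderiv a (pderiv i fun y => G y j l) z + pderiv a (pderiv j fun y => G y i l) z -
        pderiv a (pderiv l fun y => G y i j) z := by
    rw [← pderiv_add (differentiableAt_of_smooth h2) (differentiableAt_of_smooth h3),
      ← pderiv_sub (differentiableAt_of_smooth (h2.add h3)) (differentiableAt_of_smooth h4)]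
    rfl
  rw [← h5]
  simp [Matrix.one_apply]

/-- In the Leibniz expansion of `g⁻¹` times the lowered symbol, every term that differentiates `g⁻¹`
is killed: its first derivatives vanish at `z`, and its second derivatives multiply a lowered symbol
that vanishes at `z`. -/
theorem pderiv_pderiv_christoffel (a b l i j : Fin n) :
    pderiv a (pderiv b (christoffel G l i j)) z = 1 / 2 *
      (pderiv a (pderiv b (pderiv i fun y => G y j l)) z +
        pderiv a (pderiv b (pderiv j fun y => G y i l)) z -
        pderiv a (pderiv b (pderiv l fun y => G y i j)) z) := by
  have h1 : pderiv a (pderiv b (christoffel G l i j)) z = pderiv a (pderiv b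
      (fun y => 1 / 2 * ∑ k, (G y)⁻¹ l k * christoffelLower G k i j y)) z := rfl
  have hs := fun k => (h.smooth_inv l k).mul (h.smooth_christoffelLower k i j)
  rw [h1, pderiv_pderiv_const_mul (ContDiffAt.sum fun k _ => hs k),
    pderiv_pderiv_sum fun k _ => hs k]
  simp only [pderiv_pderiv_mul (h.smooth_inv _ _) (h.smooth_christoffelLower _ _ _),
    h.pderiv_inv, h.eq_one, h.christoffelLower_eq_zero]
  have h2 := contDiffAt_pderiv (h.smooth j l) i
  have h3 := contDiffAt_pderiv (h.smooth i l) j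
  have h4 := contDiffAt_pderiv (h.smooth i j) l
  have h5 : pderiv a (pderiv b (christoffelLower G l i j)) z =
      pderiv a (pderiv b (pderiv i fun y => G y j l)) z +
        pderiv a (pderiv b (pderiv j fun y => G y i l)) z -
        pderiv a (pderiv b (pderiv l fun y => G y i j)) z := by
    exact (pderiv_pderiv_sub (h2.add h3) h4 a b).trans
      (congrArg (· - _) (pderiv_pderiv_add h2 h3 a b))
  rw [← h5]
  simp [Matrix.one_apply]

theorem smooth_ricci (j k : Fin n) : ContDiffAt ℝ ∞ (ricci G j k) z :=
  ContDiffAt.sum fun _ _ => ((contDiffAt_pderiv (h.smooth_christoffel _ _ _) _).sub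
    (contDiffAt_pderiv (h.smooth_christoffel _ _ _) _)).add (ContDiffAt.sum fun _ _ =>
      ((h.smooth_christoffel _ _ _).mul (h.smooth_christoffel _ _ _)).sub
        ((h.smooth_christoffel _ _ _).mul (h.smooth_christoffel _ _ _)))

theorem ricci_eq (j k : Fin n) :
    ricci G j k z = ∑ i, (pderiv i (christoffel G i j k) z - pderiv j (christoffel G i i k) z) := by
  simp [ricci, riemann, h.christoffel_eq_zero]

/-- The terms quadratic in `Γ` vanish to second order at `z`, so they do not affect first
derivatives of Ricci. -/
theorem pderiv_ricci (a j k : Fin n) :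
    pderiv a (ricci G j k) z = ∑ i, (pderiv a (pderiv i (christoffel G i j k)) z -
      pderiv a (pderiv j (christoffel G i i k)) z) := by
  have hs := h.smooth_christoffel
  have hd := fun b l i j => contDiffAt_pderiv (hs l i j) b
  have hq : ∀ i m, ContDiffAt ℝ ∞ (fun y => christoffel G i i m y * christoffel G m j k y -
      christoffel G i j m y * christoffel G m i k y) z :=
    fun i m => ((hs _ _ _).mul (hs _ _ _)).sub ((hs _ _ _).mul (hs _ _ _))
  have h1 : pderiv a (ricci G j k) z = pderiv a (fun y => ∑ i,
      ((pderiv i (christoffel G i j k) y - pderiv j (christoffel G i i k) y) +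
        ∑ m, (christoffel G i i m y * christoffel G m j k y -
          christoffel G i j m y * christoffel G m i k y))) z := rfl
  rw [h1, pderiv_sum fun i _ => differentiableAt_of_smooth (((hd _ _ _ _).sub (hd _ _ _ _)).add
    (ContDiffAt.sum fun m _ => hq i m))]
  refine Finset.sum_congr rfl fun i _ => ?_
  rw [pderiv_add (differentiableAt_of_smooth ((hd _ _ _ _).sub (hd _ _ _ _)))
    (differentiableAt_of_smooth (ContDiffAt.sum fun m _ => hq i m)),
    pderiv_sub (differentiableAt_of_smooth (hd _ _ _ _)) (differentiableAt_of_smooth (hd _ _ _ _)),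
    pderiv_sum fun m _ => differentiableAt_of_smooth (hq i m)]
  have h2 : ∀ m, pderiv a (fun y => christoffel G i i m y * christoffel G m j k y -
      christoffel G i j m y * christoffel G m i k y) z = 0 := fun m => by
    rw [pderiv_sub (differentiableAt_of_smooth ((hs _ _ _).mul (hs _ _ _)))
      (differentiableAt_of_smooth ((hs _ _ _).mul (hs _ _ _))),
      pderiv_mul (differentiableAt_of_smooth (hs _ _ _)) (differentiableAt_of_smooth (hs _ _ _)),
      pderiv_mul (differentiableAt_of_smooth (hs _ _ _)) (differentiableAt_of_smooth (hs _ _ _))]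
    simp [h.christoffel_eq_zero]
  simp [h2]

/-- The contracted second Bianchi identity. -/
theorem contracted_bianchi (l : Fin n) :
    ∑ j, pderiv l (ricci G j j) z = 2 * ∑ j, pderiv j (ricci G j l) z := by
  have hsw : ∀ i j : Fin n, (fun y => G y i j) = fun y => G y j i := fun i j =>
    funext fun y => h.symm y i j
  have hc1 : ∀ a b c i j, pderiv a (pderiv b (pderiv c fun y => G y i j)) z =
      pderiv b (pderiv a (pderiv c fun y => G y i j)) z := fun a b c i j =>
    pderiv_comm_of_smooth (contDiffAt_pderiv (h.smooth i j) c) a b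
  have hc2 : ∀ a b c i j, pderiv a (pderiv b (pderiv c fun y => G y i j)) z =
      pderiv a (pderiv c (pderiv b fun y => G y i j)) z := fun a b c i j =>
    pderiv_congr (pderiv_comm_eventuallyEq (h.smooth i j) b c) a
  simp only [h.pderiv_ricci, h.pderiv_pderiv_christoffel]
  -- `T` is symmetric in its first three and in its last two indices. After relabelling the
  -- summation indices, both sides of the identity become `∑ T l i j i j - ∑ T l j j i i`.
  set T : Fin n → Fin n → Fin n → Fin n → Fin n → ℝ :=
    fun a b c i j => pderiv a (pderiv b (pderiv c fun y => G y i j)) z with hT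
  have e1 : ∀ a b c i j, T a b c i j = T b a c i j := hc1
  have e2 : ∀ a b c i j, T a b c i j = T a c b i j := hc2
  have e3 : ∀ a b c i j, T a b c i j = T a b c j i := fun a b c i j => by simp only [hT, hsw i j]
  have hL : ∀ j i, 1 / 2 * (T l i j j i + T l i j j i - T l i i j j) -
      1 / 2 * (T l j i j i + T l j j i i - T l j i i j) =
      (T l i j i j - 1 / 2 * T l i i j j) - 1 / 2 * T l j j i i := fun j i => by
    rw [e3 l i j j i, e2 l j i j i, e3 l i j j i, e2 l j i i j]; ring
  have hR : ∀ j i, 1 / 2 * (T j i j l i + T j i l j i - T j i i j l) -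
      1 / 2 * (T j j i l i + T j j l i i - T j j i i l) =
      1 / 2 * (T l i j i j - T l j j i i) + 1 / 2 * (T j j i i l - T j i i j l) := fun j i => by
    rw [e2 j i j l i, show T j i l j i = T l i j i j by
      rw [e3, e2, e1, e2],
      show T j j l i i = T l j j i i by rw [e2, e1]]; ring
  calc _ = ∑ j, ∑ i, ((T l i j i j - 1 / 2 * T l i i j j) - 1 / 2 * T l j j i i) :=
        Finset.sum_congr rfl fun j _ => Finset.sum_congr rfl fun i _ => hL j i
    _ = 2 * ∑ j, ∑ i, (1 / 2 * (T l i j i j - T l j j i i) +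
          1 / 2 * (T j j i i l - T j i i j l)) := ?_
    _ = _ := by
        congr 1
        exact Finset.sum_congr rfl fun j _ => Finset.sum_congr rfl fun i _ => (hR j i).symm
  have s1 : ∑ j, ∑ i, T l i i j j = ∑ j, ∑ i, T l j j i i := Finset.sum_comm
  have s2 : ∑ j, ∑ i, T j i i j l = ∑ j, ∑ i, T j j i i l := by
    rw [Finset.sum_comm]
    exact Finset.sum_congr rfl fun j _ => Finset.sum_congr rfl fun i _ => by rw [e1, e2]
  simp only [Finset.sum_add_distrib, Finset.sum_sub_distrib, ← Finset.mul_sum, s1, s2]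
  ring

end IsNormalAt

end NormalCoordinates

/-! ### The Bochner formula and the maximum principle at a normal point. -/

section Bochner

variable {n : ℕ} {G : EuclideanSpace ℝ (Fin n) → Matrix (Fin n) (Fin n) ℝ}
  {U : EuclideanSpace ℝ (Fin n) → ℝ} {z : EuclideanSpace ℝ (Fin n)}

/-- The squared norm `g^{ij} ∂_i U ∂_j U` of the gradient of `U`. -/
noncomputable def gradSq (G : EuclideanSpace ℝ (Fin n) → Matrix (Fin n) (Fin n) ℝ)
    (U : EuclideanSpace ℝ (Fin n) → ℝ) (y : EuclideanSpace ℝ (Fin n)) : ℝ :=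
  ∑ i, ∑ j, (G y)⁻¹ i j * (pderiv i U y * pderiv j U y)

theorem contDiffAt_gradSq (hG : ∀ i j, ContDiffAt ℝ ∞ (fun y => G y i j) z)
    (hdet : (G z).det ≠ 0) (hU : ContDiffAt ℝ ∞ U z) : ContDiffAt ℝ ∞ (gradSq G U) z :=
  ContDiffAt.sum fun i _ => ContDiffAt.sum fun j _ => (contDiffAt_inv_apply hG hdet i j).mul
    ((contDiffAt_pderiv hU i).mul (contDiffAt_pderiv hU j))

namespace IsNormalAt

variable (h : IsNormalAt G z) (hU : ContDiffAt ℝ ∞ U z)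
include h

theorem gradSq_eq : gradSq G U z = ∑ i, pderiv i U z ^ 2 := by
  simp [gradSq, h.eq_one, Matrix.one_apply, sq]

include hU

theorem pderiv_gradSq (a : Fin n) :
    pderiv a (gradSq G U) z = 2 * ∑ i, pderiv a (pderiv i U) z * pderiv i U z := by
  have hp := fun i => contDiffAt_pderiv hU i
  have hs := fun i j => (h.smooth_inv i j).mul ((hp i).mul (hp j))
  have h1 : pderiv a (gradSq G U) z = pderiv a
    (fun y => ∑ i, ∑ j, (G y)⁻¹ i j * (pderiv i U y * pderiv j U y)) z := rfl
  rw [h1, pderiv_sum fun i _ => differentiableAt_of_smooth (ContDiffAt.sum fun j _ => hs i j)]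
  simp only [pderiv_sum fun j _ => differentiableAt_of_smooth (hs _ j),
    pderiv_mul (differentiableAt_of_smooth (h.smooth_inv _ _))
      (differentiableAt_of_smooth ((hp _).mul (hp _))),
    pderiv_mul (differentiableAt_of_smooth (hp _)) (differentiableAt_of_smooth (hp _)),
    h.pderiv_inv, h.eq_one]
  simp only [zero_mul, zero_add, inv_one, Matrix.one_apply, ite_mul, one_mul, Finset.sum_ite_eq,
    Finset.mem_univ, if_true, Finset.mul_sum]
  exact Finset.sum_congr rfl fun i _ => by ring

theorem pderiv_pderiv_gradSq (a : Fin n) :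
    pderiv a (pderiv a (gradSq G U)) z =
      -(∑ i, ∑ j, pderiv a (pderiv a fun y => G y i j) z * (pderiv i U z * pderiv j U z)) +
        2 * ∑ i, pderiv a (pderiv i U) z ^ 2 +
        2 * ∑ i, pderiv a (pderiv a (pderiv i U)) z * pderiv i U z := by
  have hp := fun i => contDiffAt_pderiv hU i
  have hs := fun i j => (h.smooth_inv i j).mul ((hp i).mul (hp j))
  have h1 : pderiv a (pderiv a (gradSq G U)) z = pderiv a (pderiv a
    (fun y => ∑ i, ∑ j, (G y)⁻¹ i j * (pderiv i U y * pderiv j U y))) z := rfl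
  rw [h1, pderiv_pderiv_sum fun i _ => ContDiffAt.sum fun j _ => hs i j]
  simp only [pderiv_pderiv_sum fun j _ => hs _ j,
    pderiv_pderiv_mul (h.smooth_inv _ _) ((hp _).mul (hp _)),
    pderiv_pderiv_mul (hp _) (hp _), h.pderiv_pderiv_inv, h.pderiv_inv, h.eq_one]
  simp only [zero_mul, add_zero, zero_add, inv_one, Matrix.one_apply, ite_mul, one_mul,
    Finset.sum_add_distrib, Finset.sum_ite_eq, Finset.mem_univ, if_true, Finset.mul_sum, neg_mul,
    Finset.sum_neg_distrib, add_assoc, add_right_inj]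
  simp only [← Finset.sum_add_distrib]
  exact Finset.sum_congr rfl fun i _ => by ring

theorem pderiv_hessian (a i j : Fin n) :
    pderiv a (hessian G U i j) z = pderiv a (pderiv i (pderiv j U)) z -
      ∑ k, pderiv a (christoffel G k i j) z * pderiv k U z := by
  have hp := fun i => contDiffAt_pderiv hU i
  have hs := fun k => (h.smooth_christoffel k i j).mul (hp k)
  have h1 : pderiv a (hessian G U i j) z = pderiv a
    (fun y => pderiv i (pderiv j U) y - ∑ k, christoffel G k i j y * pderiv k U y) z := rfl
  rw [h1, pderiv_sub (differentiableAt_of_smooth (contDiffAt_pderiv (hp j) i))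
    (differentiableAt_of_smooth (ContDiffAt.sum fun k _ => hs k)),
    pderiv_sum fun k _ => differentiableAt_of_smooth (hs k)]
  simp only [pderiv_mul (differentiableAt_of_smooth (h.smooth_christoffel _ _ _))
    (differentiableAt_of_smooth (hp _)), h.christoffel_eq_zero]
  simp

variable {lam : ℝ} (heq : ∀ᶠ y in 𝓝 z, ∀ i j,
  lam * G y i j - ricci G i j y = hessian G U i j y)
include heq

omit hU in
theorem ricci_eq_of_soliton (i j : Fin n) :
    ricci G i j z = lam * (1 : Matrix (Fin n) (Fin n) ℝ) i j - pderiv i (pderiv j U) z := by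
  have h1 := heq.self_of_nhds i j
  simp [hessian, h.christoffel_eq_zero, h.eq_one] at h1
  linarith

theorem pderiv_ricci_of_soliton (a i j : Fin n) :
    pderiv a (ricci G i j) z = (∑ k, pderiv a (christoffel G k i j) z * pderiv k U z) -
      pderiv a (pderiv i (pderiv j U)) z := by
  have h1 : (fun y => lam * G y i j - ricci G i j y) =ᶠ[𝓝 z] hessian G U i j := by
    filter_upwards [heq] with y hy using hy i j
  have h2 := pderiv_congr h1 a
  rw [h.pderiv_hessian hU, pderiv_sub
    (differentiableAt_of_smooth (contDiffAt_const.mul (h.smooth i j)))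
    (differentiableAt_of_smooth (h.smooth_ricci i j)),
    pderiv_const_mul (differentiableAt_of_smooth (h.smooth i j)), h.pderiv_eq_zero] at h2
  linarith

/-- The gradient of the Laplacian of the potential. -/
theorem sum_pderiv_laplacian (l : Fin n) :
    ∑ j, pderiv j (pderiv j (pderiv l U)) z =
      ∑ j, ∑ k, (2 * pderiv j (christoffel G k j l) z - pderiv l (christoffel G k j j) z) *
        pderiv k U z := by
  have h1 := h.contracted_bianchi l
  -- The third derivatives of `U` now occur once on the left and twice on the right, so commuting
  -- partial derivatives lets one solve for them.
  simp only [h.pderiv_ricci_of_soliton hU heq] at h1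
  have h2 : ∀ j, pderiv l (pderiv j (pderiv j U)) z = pderiv j (pderiv j (pderiv l U)) z :=
    fun j => (pderiv_comm_of_smooth (contDiffAt_pderiv hU j) l j).trans
      (pderiv_congr (pderiv_comm_eventuallyEq hU l j) j)
  simp only [h2, Finset.sum_sub_distrib] at h1
  simp only [sub_mul, Finset.sum_sub_distrib, mul_assoc, ← Finset.mul_sum]
  linarith

/-- The Bochner formula for the potential of a gradient soliton. -/
theorem bochner :
    ∑ a, pderiv a (pderiv a (gradSq G U)) z =
      2 * ((∑ a, ∑ i, pderiv a (pderiv i U) z ^ 2) - lam * ∑ i, pderiv i U z ^ 2 +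
        ∑ k, ∑ l, pderiv k (pderiv l U) z * (pderiv k U z * pderiv l U z)) := by
  simp only [h.pderiv_pderiv_gradSq hU, Finset.sum_add_distrib, ← Finset.mul_sum,
    Finset.sum_neg_distrib]
  set p : Fin n → ℝ := fun i => pderiv i U z with hp
  set D : Fin n → Fin n → Fin n → Fin n → ℝ :=
    fun a b i j => pderiv a (pderiv b fun y => G y i j) z with hD
  have e1 : ∀ a b i j, D a b i j = D b a i j := fun a b i j =>
    pderiv_comm_of_smooth (h.smooth i j) a b
  have e2 : ∀ a b i j, D a b i j = D a b j i := fun a b i j => by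
    simp only [hD, funext fun y => h.symm y i j]
  -- `Ric(∇U, ∇U)` is computed twice, from the soliton equation and from the second derivatives of
  -- `g`. Put `A = ∑ D j j l k p_l p_k`, `B = ∑ D j k j l p_l p_k`, `C = ∑ D l k j j p_l p_k`. Then
  -- `Ric(∇U, ∇U) = B - A/2 - C/2`, while the metric terms of the Laplacian of `gradSq` are `-A +
  -- 2(A - B + C/2)`, which is `-2 Ric(∇U, ∇U)`.
  have hric : ∑ k, ∑ l, ricci G k l z * (p k * p l) =
      lam * (∑ i, p i ^ 2) - ∑ k, ∑ l, pderiv k (pderiv l U) z * (p k * p l) := by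
    simp only [h.ricci_eq_of_soliton heq, sub_mul, Finset.sum_sub_distrib]
    congr 1
    simp [Matrix.one_apply, Finset.mul_sum, sq]
  have hric2 : ∑ k, ∑ l, ricci G k l z * (p k * p l) = ∑ k, ∑ l, ∑ j,
      (1 / 2 * (D j k l j + D j l k j - D j j k l - D k l j j)) * (p k * p l) := by
    simp only [h.ricci_eq, h.pderiv_christoffel, Finset.sum_mul]
    refine Finset.sum_congr rfl fun k _ => Finset.sum_congr rfl fun l _ =>
      Finset.sum_congr rfl fun j _ => ?_
    change (1 / 2 * (D j k l j + D j l k j - D j j k l) -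
      1 / 2 * (D k j l j + D k l j j - D k j j l)) * _ = _
    rw [e2 k j j l]; ring
  have hlap : ∑ a, ∑ i, pderiv a (pderiv a (pderiv i U)) z * p i = ∑ l, ∑ k, ∑ j,
      (D j j l k + D j l j k - D j k j l - D l j j k + 1 / 2 * D l k j j) * (p l * p k) := by
    rw [Finset.sum_comm]
    refine Finset.sum_congr rfl fun l _ => ?_
    rw [← Finset.sum_mul, h.sum_pderiv_laplacian hU heq, Finset.sum_comm, Finset.sum_mul]
    refine Finset.sum_congr rfl fun k _ => ?_
    rw [Finset.sum_mul]
    refine Finset.sum_congr rfl fun j _ => ?_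
    simp only [h.pderiv_christoffel]
    change (2 * (1 / 2 * (D j j l k + D j l j k - D j k j l)) -
      1 / 2 * (D l j j k + D l j j k - D l k j j)) * p k * p l = _
    ring
  have hdd : ∑ a, ∑ i, ∑ j, D a a i j * (p i * p j) =
      ∑ l, ∑ k, ∑ j, D j j l k * (p l * p k) := by
    rw [Finset.sum_comm]
    exact Finset.sum_congr rfl fun i _ => Finset.sum_comm
  have hanti : ∑ l, ∑ k, ∑ j, D j l j k * (p l * p k) =
      ∑ l, ∑ k, ∑ j, D j k j l * (p l * p k) := by
    rw [Finset.sum_comm]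
    simp only [mul_comm]
  have hanti' : ∑ l, ∑ k, ∑ j, D l j j k * (p l * p k) =
      ∑ l, ∑ k, ∑ j, D j k j l * (p l * p k) := by
    rw [← hanti]
    simp only [e1]
  have hanti2 : ∑ k, ∑ l, ∑ j, D j k l j * (p k * p l) =
      ∑ l, ∑ k, ∑ j, D j k j l * (p l * p k) := by
    rw [← hanti]
    exact Finset.sum_congr rfl fun k _ => Finset.sum_congr rfl fun l _ =>
      Finset.sum_congr rfl fun j _ => by rw [e2]
  have hanti3 : ∑ k, ∑ l, ∑ j, D j l k j * (p k * p l) =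
      ∑ l, ∑ k, ∑ j, D j k j l * (p l * p k) :=
    Finset.sum_congr rfl fun k _ => Finset.sum_congr rfl fun l _ =>
      Finset.sum_congr rfl fun j _ => by rw [e2]
  rw [hric] at hric2
  simp only [add_mul, sub_mul, mul_add, mul_sub, Finset.sum_add_distrib, Finset.sum_sub_distrib,
    mul_assoc, ← Finset.mul_sum] at hric2 hlap hdd hanti hanti' hanti2 hanti3 ⊢
  linarith

/-- At a local maximum of `|∇U|² - ε U`, the gradient of the potential of a steady or expanding
soliton is small. -/
theorem gradSq_le_of_isLocalMax (hlam : lam ≤ 0) {ε : ℝ} (hε : 0 < ε)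
    (hmax : IsLocalMax (fun y => gradSq G U y - ε * U y) z) : gradSq G U z ≤ n * ε / 8 := by
  have hw : ContDiffAt ℝ ∞ (gradSq G U) z :=
    contDiffAt_gradSq h.smooth (by simp [h.eq_one]) hU
  have hεU : ContDiffAt ℝ ∞ (fun y => ε * U y) z := contDiffAt_const.mul hU
  have h1 : ∀ a, 2 * ∑ i, pderiv a (pderiv i U) z * pderiv i U z = ε * pderiv a U z := by
    intro a
    have := pderiv_eq_zero_of_isLocalMax hmax a
    rw [pderiv_sub (differentiableAt_of_smooth hw) (differentiableAt_of_smooth hεU),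
      pderiv_const_mul (differentiableAt_of_smooth hU), h.pderiv_gradSq hU] at this
    linarith
  have h2 : ∀ a, pderiv a (pderiv a (gradSq G U)) z ≤ ε * pderiv a (pderiv a U) z := by
    intro a
    have := pderiv_pderiv_nonpos_of_isLocalMax hmax (hw.sub hεU) a
    rw [pderiv_pderiv_sub hw hεU, pderiv_pderiv_const_mul hU] at this
    linarith
  -- The critical point equation `h1` makes `∇U` an eigenvector direction of the Hessian, with
  -- factor `ε / 2`.
  have h3 : ∑ k, ∑ l, pderiv k (pderiv l U) z * (pderiv k U z * pderiv l U z) =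
      ε / 2 * ∑ k, pderiv k U z ^ 2 := by
    rw [Finset.mul_sum]
    refine Finset.sum_congr rfl fun k _ => ?_
    calc _ = (∑ l, pderiv k (pderiv l U) z * pderiv l U z) * pderiv k U z := by
          rw [Finset.sum_mul]
          exact Finset.sum_congr rfl fun l _ => by ring
      _ = _ := by linear_combination pderiv k U z / 2 * h1 k
  have h4 : ∀ a, ε * pderiv a (pderiv a U) z - ε ^ 2 / 8 ≤
      2 * ∑ i, pderiv a (pderiv i U) z ^ 2 := by
    intro a
    have := Finset.single_le_sum (f := fun i => pderiv a (pderiv i U) z ^ 2)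
      (fun i _ => sq_nonneg _) (Finset.mem_univ a)
    -- `2x² - εx + ε²/8 = (4x - ε)²/8`; summing over the `n` diagonal entries produces the constant
    -- `n * ε / 8`.
    nlinarith [sq_nonneg (4 * pderiv a (pderiv a U) z - ε)]
  have h5 := Finset.sum_le_sum fun a (_ : a ∈ Finset.univ) => h2 a
  have h6 := Finset.sum_le_sum fun a (_ : a ∈ Finset.univ) => h4 a
  rw [h.bochner hU heq, h3] at h5
  simp only [Finset.sum_sub_distrib, ← Finset.mul_sum, Finset.sum_const, Finset.card_univ,
    Fintype.card_fin, nsmul_eq_mul] at h5 h6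
  rw [h.gradSq_eq]
  have h7 : 0 ≤ ∑ i, pderiv i U z ^ 2 := Finset.sum_nonneg fun i _ => sq_nonneg _
  have h8 : ε * ∑ i, pderiv i U z ^ 2 ≤ ε * (n * ε / 8) := by
    nlinarith [mul_nonneg (neg_nonneg.2 hlam) h7]
  exact le_of_mul_le_mul_left h8 hε

end IsNormalAt

end Bochner

/-! ### Smoothness of the metric coefficients in a chart. -/

section Charts

variable {n : ℕ} {M : Type*} [TopologicalSpace M] [ChartedSpace (EuclideanSpace ℝ (Fin n)) M]
  [IsManifold (𝓡 n) ∞ M]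
  {g : Bundle.ContMDiffRiemannianMetric (𝓡 n) ∞ (EuclideanSpace ℝ (Fin n))
      (fun x : M => TangentSpace (𝓡 n) x)}
  {e : OpenPartialHomeomorph M (EuclideanSpace ℝ (Fin n))}
  {y : EuclideanSpace ℝ (Fin n)}

theorem metricInChart_symm (y : EuclideanSpace ℝ (Fin n)) (i j : Fin n) :
    metricInChart g e y i j = metricInChart g e y j i :=
  g.symm _ _ _

omit [IsManifold (𝓡 n) ∞ M] in
theorem mdifferentiable_of_mem_maximalAtlas (he : e ∈ IsManifold.maximalAtlas (𝓡 n) ∞ M) :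
    e.MDifferentiable (𝓡 n) (𝓡 n) :=
  ⟨(contMDiffOn_of_mem_maximalAtlas he).mdifferentiableOn (by simp),
    (contMDiffOn_symm_of_mem_maximalAtlas he).mdifferentiableOn (by simp)⟩

theorem contMDiffAt_mfderiv_symm_const (he : e ∈ IsManifold.maximalAtlas (𝓡 n) ∞ M)
    (hy : y ∈ e.target) (v : EuclideanSpace ℝ (Fin n)) :
    ContMDiffAt (𝓡 n) (𝓡 n).tangent ∞
      (fun y => (⟨e.symm y, mfderiv (𝓡 n) (𝓡 n) e.symm y v⟩ : TangentBundle (𝓡 n) M)) y := by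
  have : IsManifold (𝓡 n) 1 M := IsManifold.of_le (n := ∞) (by simp)
  have hs : ContMDiffAt (𝓡 n) (𝓡 n) ∞ e.symm y := contMDiffAt_symm_of_mem_maximalAtlas he hy
  have hv : ContMDiffAt (𝓡 n) (𝓡 n).tangent ∞
      (fun y => (⟨y, v⟩ : TangentBundle (𝓡 n) (EuclideanSpace ℝ (Fin n)))) y := by
    rw [Bundle.contMDiffAt_totalSpace]
    refine ⟨contMDiffAt_id, ?_⟩
    simpa using contMDiffAt_const
  exact ContMDiffAt.clm_apply_of_inCoordinates (hs.mfderiv_const (m := ∞) (by simp)) hv hs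

theorem contDiffAt_metricInChart (he : e ∈ IsManifold.maximalAtlas (𝓡 n) ∞ M)
    (hy : y ∈ e.target) (i j : Fin n) : ContDiffAt ℝ ∞ (fun y => metricInChart g e y i j) y := by
  have hs : ContMDiffAt (𝓡 n) (𝓡 n) ∞ e.symm y := contMDiffAt_symm_of_mem_maximalAtlas he hy
  have h := ContMDiffAt.clm_bundle_apply₂ (F₁ := EuclideanSpace ℝ (Fin n))
    (F₂ := EuclideanSpace ℝ (Fin n)) (E₃ := Bundle.Trivial M ℝ) (F₃ := ℝ)
    (g.contMDiff.contMDiffAt.comp y hs)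
    (contMDiffAt_mfderiv_symm_const he hy (EuclideanSpace.single i 1))
    (contMDiffAt_mfderiv_symm_const he hy (EuclideanSpace.single j 1))
  rw [Bundle.contMDiffAt_totalSpace] at h
  exact h.2.contDiffAt

end Charts

/-! ### The gradient norm as a chart-free function. -/

section Gradient

variable {n : ℕ} {M : Type*} [TopologicalSpace M] [ChartedSpace (EuclideanSpace ℝ (Fin n)) M]

theorem euclideanSpace_eq_sum_single (v : EuclideanSpace ℝ (Fin n)) :
    v = ∑ i, v i • EuclideanSpace.single i (1 : ℝ) := by
  simpa using ((EuclideanSpace.basisFun (Fin n) ℝ).sum_repr v).symm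

theorem map_eq_sum_single {F : Type*} [AddCommGroup F] [Module ℝ F] [TopologicalSpace F]
    (L : EuclideanSpace ℝ (Fin n) →L[ℝ] F) (v : EuclideanSpace ℝ (Fin n)) :
    L v = ∑ i, v i • L (EuclideanSpace.single i 1) := by
  conv_lhs => rw [euclideanSpace_eq_sum_single v]
  simp

variable [IsManifold (𝓡 n) ∞ M]
  {g : Bundle.ContMDiffRiemannianMetric (𝓡 n) ∞ (EuclideanSpace ℝ (Fin n))
      (fun x : M => TangentSpace (𝓡 n) x)}
  {e : OpenPartialHomeomorph M (EuclideanSpace ℝ (Fin n))}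
  {y : EuclideanSpace ℝ (Fin n)} {u : M → ℝ}

theorem inner_mfderiv_symm (v w : EuclideanSpace ℝ (Fin n)) :
    g.inner (e.symm y) (mfderiv (𝓡 n) (𝓡 n) e.symm y v) (mfderiv (𝓡 n) (𝓡 n) e.symm y w) =
      ∑ i, ∑ j, v i * w j * metricInChart g e y i j := by
  have h1 : ∀ a : TangentSpace (𝓡 n) (e.symm y),
      g.inner (e.symm y) a (mfderiv (𝓡 n) (𝓡 n) e.symm y w) =
      ∑ j, w j * g.inner (e.symm y) a
        (mfderiv (𝓡 n) (𝓡 n) e.symm y (EuclideanSpace.single j (1 : ℝ))) := fun a =>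
    map_eq_sum_single ((g.inner (e.symm y) a).comp (mfderiv (𝓡 n) (𝓡 n) e.symm y)) w
  have h2 : ∀ b : TangentSpace (𝓡 n) (e.symm y),
      g.inner (e.symm y) (mfderiv (𝓡 n) (𝓡 n) e.symm y v) b =
      ∑ i, v i * g.inner (e.symm y)
        (mfderiv (𝓡 n) (𝓡 n) e.symm y (EuclideanSpace.single i (1 : ℝ))) b := fun b => by
    simp only [g.symm _ _ b]
    exact map_eq_sum_single ((g.inner (e.symm y) b).comp (mfderiv (𝓡 n) (𝓡 n) e.symm y)) v
  rw [h2]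
  refine Finset.sum_congr rfl fun i _ => ?_
  rw [h1, Finset.mul_sum]
  exact Finset.sum_congr rfl fun j _ => by rw [mul_assoc]; rfl

theorem mfderiv_symm_bijective (he : e ∈ IsManifold.maximalAtlas (𝓡 n) ∞ M)
    (hy : y ∈ e.target) : Function.Bijective (mfderiv (𝓡 n) (𝓡 n) e.symm y) := by
  have : IsManifold (𝓡 n) 1 M := IsManifold.of_le (n := ∞) (by simp)
  exact (mdifferentiable_of_mem_maximalAtlas he).symm.mfderiv_bijective hy

theorem exists_mfderiv_symm_eq (he : e ∈ IsManifold.maximalAtlas (𝓡 n) ∞ M)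
    (hy : y ∈ e.target) (X : TangentSpace (𝓡 n) (e.symm y)) :
    ∃ v : EuclideanSpace ℝ (Fin n), mfderiv (𝓡 n) (𝓡 n) e.symm y v = X :=
  (mfderiv_symm_bijective he hy).2 X

theorem metricInChart_pos (he : e ∈ IsManifold.maximalAtlas (𝓡 n) ∞ M) (hy : y ∈ e.target)
    {v : EuclideanSpace ℝ (Fin n)} (hv : v ≠ 0) :
    0 < ∑ i, ∑ j, v i * v j * metricInChart g e y i j := by
  rw [← inner_mfderiv_symm]
  refine g.pos _ _ fun h0 => hv ?_
  exact (mfderiv_symm_bijective he hy).1 (h0.trans (map_zero _).symm)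

open Matrix in
theorem posDef_metricInChart (he : e ∈ IsManifold.maximalAtlas (𝓡 n) ∞ M) (hy : y ∈ e.target) :
    (metricInChart g e y).PosDef := by
  refine Matrix.PosDef.of_dotProduct_mulVec_pos
    (Matrix.IsHermitian.ext fun i j => metricInChart_symm y j i) fun {x} hx => ?_
  have := metricInChart_pos (g := g) he hy (v := WithLp.toLp 2 x) (by simpa using hx)
  simp only [dotProduct, mulVec, Finset.mul_sum]
  refine this.trans_eq (Finset.sum_congr rfl fun i _ => Finset.sum_congr rfl fun j _ => ?_)
  simp
  ring

theorem det_metricInChart_ne_zero (he : e ∈ IsManifold.maximalAtlas (𝓡 n) ∞ M)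
    (hy : y ∈ e.target) : (metricInChart g e y).det ≠ 0 :=
  (posDef_metricInChart he hy).det_pos.ne'

/-- `X` is the gradient of `u` at `x`. -/
def IsGradient (g : Bundle.ContMDiffRiemannianMetric (𝓡 n) ∞ (EuclideanSpace ℝ (Fin n))
      (fun x : M => TangentSpace (𝓡 n) x)) (u : M → ℝ) (x : M) (X : TangentSpace (𝓡 n) x) : Prop :=
  ∀ v : TangentSpace (𝓡 n) x, g.inner x X v = mfderiv (𝓡 n) 𝓘(ℝ, ℝ) u x v

/-- The squared norm `du(∇u)` of the gradient of `u`. -/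
noncomputable def gradNormSq
    (g : Bundle.ContMDiffRiemannianMetric (𝓡 n) ∞ (EuclideanSpace ℝ (Fin n))
      (fun x : M => TangentSpace (𝓡 n) x)) (u : M → ℝ) (x : M) : ℝ :=
  mfderiv (𝓡 n) 𝓘(ℝ, ℝ) u x (Classical.epsilon (IsGradient g u x))

omit [IsManifold (𝓡 n) ∞ M] in
theorem fderiv_comp_symm (he : e ∈ IsManifold.maximalAtlas (𝓡 n) ∞ M) (hy : y ∈ e.target)
    (hu : ContMDiff (𝓡 n) 𝓘(ℝ, ℝ) ∞ u) (v : EuclideanSpace ℝ (Fin n)) :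
    fderiv ℝ (fun z => u (e.symm z)) y v =
      mfderiv (𝓡 n) 𝓘(ℝ, ℝ) u (e.symm y) (mfderiv (𝓡 n) (𝓡 n) e.symm y v) := by
  have h := mfderiv_comp y (hu.mdifferentiableAt (by simp))
    ((mdifferentiable_of_mem_maximalAtlas he).mdifferentiableAt_symm hy)
  rw [mfderiv_eq_fderiv] at h
  exact DFunLike.congr_fun h v

omit [IsManifold (𝓡 n) ∞ M] in
theorem contDiffAt_comp_symm (he : e ∈ IsManifold.maximalAtlas (𝓡 n) ∞ M) (hy : y ∈ e.target)
    (hu : ContMDiff (𝓡 n) 𝓘(ℝ, ℝ) ∞ u) : ContDiffAt ℝ ∞ (fun z => u (e.symm z)) y :=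
  (hu.contMDiffAt.comp y (contMDiffAt_symm_of_mem_maximalAtlas he hy)).contDiffAt

-- In coordinates, being the gradient means solving `G ξ = p` with `p` the partial derivatives of
-- `u`. As `G` is invertible, the solution exists and is unique, so the `Classical.epsilon` in
-- `gradNormSq` selects `G⁻¹ p`.
open Matrix in
theorem gradNormSq_symm (he : e ∈ IsManifold.maximalAtlas (𝓡 n) ∞ M) (hy : y ∈ e.target)
    (hu : ContMDiff (𝓡 n) 𝓘(ℝ, ℝ) ∞ u) :
    gradNormSq g u (e.symm y) = gradSq (metricInChart g e) (fun z => u (e.symm z)) y := by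
  set p : Fin n → ℝ := fun i => pderiv i (fun z => u (e.symm z)) y with hp
  set G := metricInChart g e y with hG
  have hdet : IsUnit G.det := (det_metricInChart_ne_zero he hy).isUnit
  have hdu : ∀ w : EuclideanSpace ℝ (Fin n),
      mfderiv (𝓡 n) 𝓘(ℝ, ℝ) u (e.symm y) (mfderiv (𝓡 n) (𝓡 n) e.symm y w) = ∑ j, w j * p j := by
    intro w
    rw [← fderiv_comp_symm he hy hu, map_eq_sum_single]
    rfl
  have hiff : ∀ ξ : EuclideanSpace ℝ (Fin n),
      IsGradient g u (e.symm y) (mfderiv (𝓡 n) (𝓡 n) e.symm y ξ) ↔ G *ᵥ ξ = p := by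
    intro ξ
    have h1 : ∀ w : EuclideanSpace ℝ (Fin n),
        g.inner (e.symm y) (mfderiv (𝓡 n) (𝓡 n) e.symm y ξ)
          (mfderiv (𝓡 n) (𝓡 n) e.symm y w) = ∑ j, w j * (G *ᵥ ξ) j := by
      intro w
      rw [inner_mfderiv_symm, Finset.sum_comm]
      simp only [mulVec, dotProduct, Finset.mul_sum]
      refine Finset.sum_congr rfl fun j _ => Finset.sum_congr rfl fun i _ => ?_
      rw [metricInChart_symm]
      ring
    constructor
    · intro h
      ext j
      have := h (mfderiv (𝓡 n) (𝓡 n) e.symm y (EuclideanSpace.single j (1 : ℝ)))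
      rw [h1, hdu] at this
      simpa using this
    · intro h v
      obtain ⟨w, rfl⟩ := exists_mfderiv_symm_eq he hy v
      exact (h1 w).trans (by rw [h, hdu])
  have hex : ∃ X, IsGradient g u (e.symm y) X := by
    refine ⟨_, (hiff (WithLp.toLp 2 (G⁻¹ *ᵥ p))).2 ?_⟩
    simp [mulVec_mulVec, mul_nonsing_inv _ hdet]
  have hε := Classical.epsilon_spec hex
  obtain ⟨ξ, hξ⟩ := exists_mfderiv_symm_eq he hy
    (Classical.epsilon (IsGradient g u (e.symm y)))
  have hGξ : G *ᵥ ξ = p := (hiff ξ).1 (by rw [hξ]; exact hε)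
  have hξp : (ξ : Fin n → ℝ) = G⁻¹ *ᵥ p := by
    rw [← hGξ, mulVec_mulVec, nonsing_inv_mul _ hdet, one_mulVec]
  rw [gradNormSq, ← hξ]
  refine (hdu ξ).trans ?_
  rw [gradSq]
  refine Finset.sum_congr rfl fun i _ => ?_
  rw [hξp, mulVec, dotProduct, Finset.sum_mul]
  exact Finset.sum_congr rfl fun j _ => by
    change _ = G⁻¹ i j * (p i * p j)
    ring

theorem continuous_gradNormSq (hu : ContMDiff (𝓡 n) 𝓘(ℝ, ℝ) ∞ u) :
    Continuous (gradNormSq g u) := by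
  refine continuous_iff_continuousAt.2 fun x => ?_
  set e := chartAt (EuclideanSpace ℝ (Fin n)) x with he'
  have he : e ∈ IsManifold.maximalAtlas (𝓡 n) ∞ M := IsManifold.chart_mem_maximalAtlas x
  have hx : x ∈ e.source := mem_chart_source _ x
  have hy : e x ∈ e.target := e.map_source hx
  have h1 : gradNormSq g u =ᶠ[𝓝 x]
      fun x' => gradSq (metricInChart g e) (fun z => u (e.symm z)) (e x') := by
    filter_upwards [e.open_source.mem_nhds hx] with x' hx'
    rw [← gradNormSq_symm he (e.map_source hx') hu, e.left_inv hx']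
  refine ContinuousAt.congr ?_ h1.symm
  have h2 : ContinuousAt (gradSq (metricInChart g e) (fun z => u (e.symm z))) (e x) :=
    (contDiffAt_gradSq (contDiffAt_metricInChart he hy)
      (det_metricInChart_ne_zero he hy) (contDiffAt_comp_symm he hy hu)).continuousAt
  exact h2.comp (e.continuousAt hx)

/-- The inverse metric is positive definite, so all partial derivatives of `u` vanish in a chart. -/
theorem isLocallyConstant_of_gradNormSq_nonpos (hu : ContMDiff (𝓡 n) 𝓘(ℝ, ℝ) ∞ u)
    (h0 : ∀ x, gradNormSq g u x ≤ 0) : IsLocallyConstant u := by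
  refine (IsLocallyConstant.iff_eventually_eq u).2 fun x => ?_
  set e := chartAt (EuclideanSpace ℝ (Fin n)) x with he'
  have he : e ∈ IsManifold.maximalAtlas (𝓡 n) ∞ M := IsManifold.chart_mem_maximalAtlas x
  have hx : x ∈ e.source := mem_chart_source _ x
  have hpd : ∀ y ∈ e.target, fderiv ℝ (fun z => u (e.symm z)) y = 0 := by
    intro y hy
    have h1 := h0 (e.symm y)
    rw [gradNormSq_symm he hy hu] at h1
    have hp : (fun i => pderiv i (fun z => u (e.symm z)) y) = 0 := by
      by_contra hne
      have hpos := (posDef_metricInChart (g := g) he hy).inv.dotProduct_mulVec_pos hne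
      refine hpos.not_ge (le_trans (le_of_eq ?_) h1)
      simp only [dotProduct, Matrix.mulVec, Finset.mul_sum, gradSq]
      exact Finset.sum_congr rfl fun i _ => Finset.sum_congr rfl fun j _ => by simp; ring
    ext v
    rw [map_eq_sum_single]
    exact Finset.sum_eq_zero fun i _ => by
      rw [show fderiv ℝ (fun z => u (e.symm z)) y (EuclideanSpace.single i 1) = 0 from
        congrFun hp i, smul_zero]
  have hopen := e.open_target.isOpen_inter_preimage_of_fderiv_eq_zero (𝕜 := ℝ)
    (fun y hy => ((contDiffAt_comp_symm he hy hu).differentiableAt (by simp)).differentiableWithinAt)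
    (fun y hy => hpd y hy) {u x}
  have hmem : e.target ∩ (fun z => u (e.symm z)) ⁻¹' {u x} ∈ 𝓝 (e x) :=
    hopen.mem_nhds ⟨e.map_source hx, by simp [e.left_inv hx]⟩
  filter_upwards [e.continuousAt hx hmem, e.open_source.mem_nhds hx] with x' h1 h2
  simpa [e.left_inv h2] using h1.2

end Gradient

/-! ### Existence of charts that are normal to first order. -/

section NormalChart

variable {n : ℕ} {M : Type*} [TopologicalSpace M] [ChartedSpace (EuclideanSpace ℝ (Fin n)) M]
  [IsManifold (𝓡 n) ∞ M]
  {g : Bundle.ContMDiffRiemannianMetric (𝓡 n) ∞ (EuclideanSpace ℝ (Fin n))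
      (fun x : M => TangentSpace (𝓡 n) x)}

/-- The transformation law `g' = Jᵀ g J`, from the chain rule. -/
theorem metricInChart_comp {e e' : OpenPartialHomeomorph M (EuclideanSpace ℝ (Fin n))}
    (he : e ∈ IsManifold.maximalAtlas (𝓡 n) ∞ M)
    {φ : EuclideanSpace ℝ (Fin n) → EuclideanSpace ℝ (Fin n)} {z : EuclideanSpace ℝ (Fin n)}
    (hφ : DifferentiableAt ℝ φ z) (hz : φ z ∈ e.target)
    (he' : (e'.symm : EuclideanSpace ℝ (Fin n) → M) = fun w => e.symm (φ w)) (i j : Fin n) :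
    metricInChart g e' z i j = ∑ a, ∑ b, fderiv ℝ φ z (EuclideanSpace.single i 1) a *
      fderiv ℝ φ z (EuclideanSpace.single j 1) b * metricInChart g e (φ z) a b := by
  have h := mfderiv_comp z ((mdifferentiable_of_mem_maximalAtlas he).mdifferentiableAt_symm hz)
    hφ.mdifferentiableAt
  rw [mfderiv_eq_fderiv] at h
  rw [← inner_mfderiv_symm]
  simp only [metricInChart, Matrix.of_apply]
  rw [he']
  have h' : ∀ v : EuclideanSpace ℝ (Fin n), mfderiv (𝓡 n) (𝓡 n) (fun w => e.symm (φ w)) z v =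
      mfderiv (𝓡 n) (𝓡 n) e.symm (φ z) (fderiv ℝ φ z v) := DFunLike.congr_fun h
  exact congrArg₂ (fun a b => g.inner (e.symm (φ z)) a b) (h' _) (h' _)

/-- Reparametrization of a chart by a smooth map which is a local diffeomorphism at a point. -/
theorem exists_chart_comp {e : OpenPartialHomeomorph M (EuclideanSpace ℝ (Fin n))}
    (he : e ∈ IsManifold.maximalAtlas (𝓡 n) ∞ M)
    {φ : EuclideanSpace ℝ (Fin n) → EuclideanSpace ℝ (Fin n)} {z : EuclideanSpace ℝ (Fin n)}
    (hφ : ContDiff ℝ ∞ φ) (hz : φ z ∈ e.target)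
    {L : EuclideanSpace ℝ (Fin n) ≃L[ℝ] EuclideanSpace ℝ (Fin n)}
    (hL : HasFDerivAt φ (L : EuclideanSpace ℝ (Fin n) →L[ℝ] EuclideanSpace ℝ (Fin n)) z) :
    ∃ e' ∈ IsManifold.maximalAtlas (𝓡 n) ∞ M, z ∈ e'.target ∧
      (∀ w ∈ e'.target, φ w ∈ e.target) ∧
      (e'.symm : EuclideanSpace ℝ (Fin n) → M) = fun w => e.symm (φ w) := by
  -- A chart needs a smooth inverse on its whole domain, whereas invertibility of the derivative is
  -- given only at `z`. Hence the restriction to the open set where the derivative of `φ` is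
  -- invertible.
  set S : Set (EuclideanSpace ℝ (Fin n)) := {w | fderiv ℝ φ w ∈ Set.range
    ((↑) : (EuclideanSpace ℝ (Fin n) ≃L[ℝ] EuclideanSpace ℝ (Fin n)) →
      (EuclideanSpace ℝ (Fin n) →L[ℝ] EuclideanSpace ℝ (Fin n)))} with hS
  have hSo : IsOpen S := ContinuousLinearEquiv.isOpen.preimage (hφ.continuous_fderiv (by simp))
  set Φ := ((hφ.contDiffAt (x := z)).toOpenPartialHomeomorph φ hL (by simp)).restrOpen S hSo with hΦ
  have hΦφ : (Φ : EuclideanSpace ℝ (Fin n) → EuclideanSpace ℝ (Fin n)) = φ := rfl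
  have hzΦ : z ∈ Φ.source :=
    ⟨(hφ.contDiffAt (x := z)).mem_toOpenPartialHomeomorph_source hL (by simp), L, hL.fderiv.symm⟩
  have hΦsymm : ∀ y ∈ Φ.target, ContDiffAt ℝ ∞ Φ.symm y := by
    intro y hy
    obtain ⟨L', hL'⟩ : Φ.symm y ∈ S := (Φ.map_target hy).2
    refine Φ.contDiffAt_symm hy (f₀' := L') ?_ hφ.contDiffAt
    rw [hL']
    exact (hφ.differentiable (by simp) _).hasFDerivAt
  refine ⟨e.trans Φ.symm, ?_, ?_, ?_, ?_⟩
  · refine OpenPartialHomeomorph.mem_maximalAtlas_of_contMDiffOn _ ?_ ?_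
    · intro x hx
      rw [OpenPartialHomeomorph.trans_source] at hx
      exact ((hΦsymm _ hx.2).contMDiffAt.comp x
        (contMDiffAt_of_mem_maximalAtlas he hx.1)).contMDiffWithinAt
    · intro w hw
      rw [OpenPartialHomeomorph.trans_target] at hw
      exact ((contMDiffAt_symm_of_mem_maximalAtlas he hw.2).comp w
        hφ.contMDiff.contMDiffAt).contMDiffWithinAt
  · rw [OpenPartialHomeomorph.trans_target]
    exact ⟨hzΦ, hz⟩
  · intro w hw
    rw [OpenPartialHomeomorph.trans_target] at hw
    exact hw.2
  · rfl

-- Factor `G = Bᵀ B` and take `A = B⁻¹`.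
open Matrix MatrixOrder in
theorem _root_.Matrix.PosDef.exists_transpose_mul_mul_eq_one {ι : Type*} [Fintype ι]
    [DecidableEq ι] {G : Matrix ι ι ℝ} (hG : G.PosDef) : ∃ A : Matrix ι ι ℝ,
      A.det ≠ 0 ∧ Aᵀ * G * A = 1 := by
  obtain ⟨B, hB⟩ := CStarAlgebra.nonneg_iff_eq_star_mul_self.1 hG.posSemidef.nonneg
  have hB' : G = Bᵀ * B := by simpa [Matrix.star_eq_conjTranspose] using hB
  have hdet : B.det ≠ 0 := fun h => hG.det_pos.ne' (by rw [hB', det_mul, h, mul_zero])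
  refine ⟨B⁻¹, by simpa [det_nonsing_inv] using hdet, ?_⟩
  rw [hB', Matrix.mul_assoc, Matrix.mul_assoc, mul_nonsing_inv _ hdet.isUnit, Matrix.mul_one,
    ← transpose_mul, mul_nonsing_inv _ hdet.isUnit, transpose_one]

/-- There is a chart around every point in which the metric is the identity at that point. -/
theorem exists_chart_metric_eq_one (p : M) :
    ∃ e ∈ IsManifold.maximalAtlas (𝓡 n) ∞ M, ∃ z ∈ e.target, e.symm z = p ∧
      metricInChart g e z = 1 := by
  set e := chartAt (EuclideanSpace ℝ (Fin n)) p with he_def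
  have he : e ∈ IsManifold.maximalAtlas (𝓡 n) ∞ M := IsManifold.chart_mem_maximalAtlas p
  have hp : p ∈ e.source := mem_chart_source _ p
  obtain ⟨A, hA, hAG⟩ :=
    (posDef_metricInChart (g := g) he (e.map_source hp)).exists_transpose_mul_mul_eq_one
  have hdet : (LinearMap.toContinuousLinearMap (Matrix.toEuclideanLin A)).det ≠ 0 := by
    rw [ContinuousLinearMap.det, LinearMap.coe_toContinuousLinearMap,
      Matrix.toEuclideanLin_eq_toLin_orthonormal, LinearMap.det_toLin]
    exact hA
  set L := (LinearMap.toContinuousLinearMap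
    (Matrix.toEuclideanLin A)).toContinuousLinearEquivOfDetNeZero hdet with hL
  have hLA : ∀ i a, L (EuclideanSpace.single i 1) a = A a i := fun i a => by
    simp [hL, Matrix.toLpLin_apply]
  set z := L.symm (e p) with hz
  have hLz : L z = e p := L.apply_symm_apply _
  obtain ⟨e', he', hz', -, hsymm⟩ := exists_chart_comp he (φ := L) (z := z) L.contDiff
    (by rw [hLz]; exact e.map_source hp) L.hasFDerivAt
  refine ⟨e', he', z, hz', by rw [hsymm]; simp [hLz, e.left_inv hp], ?_⟩
  ext i j
  rw [metricInChart_comp he L.differentiableAt (by rw [hLz]; exact e.map_source hp) hsymm, ← hAG,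
    Matrix.mul_apply, Finset.sum_comm, L.fderiv, hLz]
  refine Finset.sum_congr rfl fun b _ => ?_
  rw [Matrix.mul_apply, Finset.sum_mul]
  refine Finset.sum_congr rfl fun a _ => ?_
  change L _ a * L _ b * _ = _
  rw [hLA, hLA, Matrix.transpose_apply]
  ring

theorem pderiv_coord (i m : Fin n) (w : EuclideanSpace ℝ (Fin n)) :
    pderiv i (fun w : EuclideanSpace ℝ (Fin n) => w m) w =
      (1 : Matrix (Fin n) (Fin n) ℝ) m i := by
  have h : HasFDerivAt (fun w : EuclideanSpace ℝ (Fin n) => w m)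
      (EuclideanSpace.proj (𝕜 := ℝ) m : EuclideanSpace ℝ (Fin n) →L[ℝ] ℝ) w :=
    (EuclideanSpace.proj (𝕜 := ℝ) m : EuclideanSpace ℝ (Fin n) →L[ℝ] ℝ).hasFDerivAt
  simp [pderiv, h.fderiv, Matrix.one_apply]

/-- The quadratic change of coordinates `w ↦ w - C(w - z, w - z) / 2`. -/
noncomputable def quadraticShift (C : Fin n → Fin n → Fin n → ℝ) (z w : EuclideanSpace ℝ (Fin n)) :
    EuclideanSpace ℝ (Fin n) :=
  WithLp.toLp 2 fun m => w m - 1 / 2 * ∑ k, ∑ l, C m k l * ((w k - z k) * (w l - z l))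

section QuadraticShift

variable {C : Fin n → Fin n → Fin n → ℝ} {z : EuclideanSpace ℝ (Fin n)}

theorem quadraticShift_self : quadraticShift C z z = z := by
  ext m
  simp [quadraticShift]

theorem contDiff_coord (m : Fin n) : ContDiff ℝ ∞ fun w : EuclideanSpace ℝ (Fin n) => w m :=
  (EuclideanSpace.proj (𝕜 := ℝ) m).contDiff

theorem contDiff_quadraticShift : ContDiff ℝ ∞ (quadraticShift C z) := by
  refine contDiff_euclidean.2 fun m => (contDiff_coord m).sub (contDiff_const.mul
    (ContDiff.sum fun k _ => ContDiff.sum fun l _ => contDiff_const.mul ?_))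
  exact ((contDiff_coord k).sub contDiff_const).mul ((contDiff_coord l).sub contDiff_const)

theorem fderiv_quadraticShift (hC : ∀ m k l, C m k l = C m l k) (w : EuclideanSpace ℝ (Fin n))
    (i m : Fin n) : fderiv ℝ (quadraticShift C z) w (EuclideanSpace.single i 1) m =
      (1 : Matrix (Fin n) (Fin n) ℝ) m i - ∑ l, C m i l * (w l - z l) := by
  have h1 : fderiv ℝ (quadraticShift C z) w (EuclideanSpace.single i 1) m =
      pderiv i (fun w : EuclideanSpace ℝ (Fin n) =>
        w m - 1 / 2 * ∑ k, ∑ l, C m k l * ((w k - z k) * (w l - z l))) w := by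
    have h2 := (EuclideanSpace.proj (𝕜 := ℝ) m).hasFDerivAt.comp w
      ((contDiff_quadraticShift (C := C) (z := z)).differentiable (by simp) w).hasFDerivAt
    exact (DFunLike.congr_fun h2.fderiv (EuclideanSpace.single i 1)).symm
  have hd : ∀ k, DifferentiableAt ℝ (fun w : EuclideanSpace ℝ (Fin n) => w k) w := fun k =>
    (contDiff_coord k).differentiable (by simp) w
  have hd' : ∀ k, DifferentiableAt ℝ (fun w : EuclideanSpace ℝ (Fin n) => w k - z k) w :=
    fun k => (hd k).sub_const _
  have hds : ∀ k l, DifferentiableAt ℝ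
      (fun w : EuclideanSpace ℝ (Fin n) => C m k l * ((w k - z k) * (w l - z l))) w := fun k l =>
    ((hd' k).fun_mul (hd' l)).const_mul _
  have hdk : ∀ k, DifferentiableAt ℝ
      (fun w : EuclideanSpace ℝ (Fin n) => ∑ l, C m k l * ((w k - z k) * (w l - z l))) w :=
    fun k => DifferentiableAt.fun_sum fun l _ => hds k l
  have hp : ∀ k, pderiv i (fun w : EuclideanSpace ℝ (Fin n) => w k - z k) w =
      (1 : Matrix (Fin n) (Fin n) ℝ) k i := fun k => by
    rw [pderiv_sub (hd k) (differentiableAt_const _), pderiv_coord, pderiv_const, sub_zero]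
  have hp2 : ∀ k l, pderiv i
      (fun w : EuclideanSpace ℝ (Fin n) => C m k l * ((w k - z k) * (w l - z l))) w =
      C m k l * ((1 : Matrix (Fin n) (Fin n) ℝ) k i * (w l - z l) +
        (w k - z k) * (1 : Matrix (Fin n) (Fin n) ℝ) l i) := fun k l => by
    rw [pderiv_const_mul ((hd' k).fun_mul (hd' l)), pderiv_mul (hd' k) (hd' l), hp, hp]
  rw [h1, pderiv_sub (hd m) ((DifferentiableAt.fun_sum fun k _ => hdk k).const_mul _),
    pderiv_const_mul (DifferentiableAt.fun_sum fun k _ => hdk k),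
    pderiv_sum fun k _ => hdk k, pderiv_coord]
  simp only [pderiv_sum fun l _ => hds _ l, hp2, mul_add, Finset.sum_add_distrib]
  have e1 : ∑ k, ∑ l, C m k l * ((1 : Matrix (Fin n) (Fin n) ℝ) k i * (w l - z l)) =
      ∑ l, C m i l * (w l - z l) := by
    rw [Finset.sum_comm]
    simp [Matrix.one_apply]
  have e2 : ∑ k, ∑ l, C m k l * ((w k - z k) * (1 : Matrix (Fin n) (Fin n) ℝ) l i) =
      ∑ l, C m i l * (w l - z l) := by
    simp [Matrix.one_apply, hC m i]
  rw [e1, e2]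
  ring

theorem fderiv_quadraticShift_self (hC : ∀ m k l, C m k l = C m l k) :
    fderiv ℝ (quadraticShift C z) z = ContinuousLinearMap.id ℝ _ := by
  ext v m
  rw [map_eq_sum_single]
  simp [fderiv_quadraticShift hC, Matrix.one_apply]

end QuadraticShift

/-- Existence of normal coordinates to first order. -/
theorem exists_normal_chart (p : M) :
    ∃ e ∈ IsManifold.maximalAtlas (𝓡 n) ∞ M, ∃ z ∈ e.target, e.symm z = p ∧
      IsNormalAt (metricInChart g e) z := by
  obtain ⟨e, he, z, hz, hzp, hone⟩ := exists_chart_metric_eq_one (g := g) p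
  set d : Fin n → Fin n → Fin n → ℝ :=
    fun k i j => pderiv k (fun y => metricInChart g e y i j) z with hd
  have hdsymm : ∀ k i j, d k i j = d k j i := fun k i j => by
    simp only [hd, metricInChart_symm _ i j]
  -- These are the Christoffel symbols at `z`, where the metric is the identity. The shift changes
  -- `∂_k g_ij` by `-(C j i k + C i j k)`, which is exactly `-d k i j`.
  set C : Fin n → Fin n → Fin n → ℝ :=
    fun m k l => 1 / 2 * (d k l m + d l k m - d m k l) with hCdef
  have hC : ∀ m k l, C m k l = C m l k := fun m k l => by
    simp only [hCdef, hdsymm m k l]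
    ring
  have hφ := contDiff_quadraticShift (C := C) (z := z)
  have hφz : quadraticShift C z z = z := quadraticShift_self
  have hφ' : HasFDerivAt (quadraticShift C z) ((ContinuousLinearEquiv.refl ℝ _ :
      EuclideanSpace ℝ (Fin n) ≃L[ℝ] EuclideanSpace ℝ (Fin n)) : _ →L[ℝ] _) z := by
    have := (hφ.differentiable (by simp) z).hasFDerivAt
    rwa [fderiv_quadraticShift_self hC] at this
  obtain ⟨e', he', hz', htgt, hsymm⟩ := exists_chart_comp he hφ (by rwa [hφz]) hφ'
  have hform : ∀ w ∈ e'.target, ∀ i j, metricInChart g e' w i j = ∑ a, ∑ b,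
      ((1 : Matrix (Fin n) (Fin n) ℝ) a i - ∑ l, C a i l * (w l - z l)) *
      ((1 : Matrix (Fin n) (Fin n) ℝ) b j - ∑ l, C b j l * (w l - z l)) *
      metricInChart g e (quadraticShift C z w) a b := fun w hw i j => by
    rw [metricInChart_comp he (hφ.differentiable (by simp) w) (htgt w hw) hsymm]
    simp only [fderiv_quadraticShift hC]
  refine ⟨e', he', z, hz', by rw [hsymm]; simp only [hφz, hzp],
    ⟨contDiffAt_metricInChart he' hz', metricInChart_symm, ?_, fun k i j => ?_⟩⟩
  · ext i j
    rw [hform z hz', hφz, hone]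
    simp [Matrix.one_apply, eq_comm]
  · have hev : (fun w => metricInChart g e' w i j) =ᶠ[𝓝 z] fun w => ∑ a, ∑ b,
        ((1 : Matrix (Fin n) (Fin n) ℝ) a i - ∑ l, C a i l * (w l - z l)) *
        ((1 : Matrix (Fin n) (Fin n) ℝ) b j - ∑ l, C b j l * (w l - z l)) *
        metricInChart g e (quadraticShift C z w) a b := by
      filter_upwards [e'.open_target.mem_nhds hz'] with w hw using hform w hw i j
    have hcd : ∀ c l, DifferentiableAt ℝ
        (fun w : EuclideanSpace ℝ (Fin n) => c * (w l - z l)) z := fun c l =>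
      (((contDiff_coord l).differentiable (by simp) z).sub_const _).const_mul c
    have hJd : ∀ a i, DifferentiableAt ℝ (fun w : EuclideanSpace ℝ (Fin n) =>
        (1 : Matrix (Fin n) (Fin n) ℝ) a i - ∑ l, C a i l * (w l - z l)) z := fun a i =>
      (differentiableAt_const _).sub (DifferentiableAt.fun_sum fun l _ => hcd _ l)
    have hJ : ∀ a i, pderiv k (fun w : EuclideanSpace ℝ (Fin n) =>
        (1 : Matrix (Fin n) (Fin n) ℝ) a i - ∑ l, C a i l * (w l - z l)) z = -C a i k := by
      intro a i
      rw [pderiv_sub (differentiableAt_const _) (DifferentiableAt.fun_sum fun l _ => hcd _ l),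
        pderiv_const, pderiv_sum fun l _ => hcd _ l]
      have : ∀ l, pderiv k (fun w : EuclideanSpace ℝ (Fin n) => C a i l * (w l - z l)) z =
          C a i l * (1 : Matrix (Fin n) (Fin n) ℝ) l k := fun l => by
        have hl := (contDiff_coord l).differentiable (n := ∞) (by simp) z
        rw [pderiv_const_mul (hl.sub_const _), pderiv_sub hl (differentiableAt_const _),
          pderiv_coord, pderiv_const, sub_zero]
      simp [this, Matrix.one_apply]
    have hGat : ∀ a b, HasFDerivAt (fun w => metricInChart g e (quadraticShift C z w) a b)
        (fderiv ℝ (fun y => metricInChart g e y a b) z) z := fun a b => by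
      have h1 : HasFDerivAt (fun y => metricInChart g e y a b)
          (fderiv ℝ (fun y => metricInChart g e y a b) z) (quadraticShift C z z) := by
        rw [hφz]
        exact (differentiableAt_of_smooth (contDiffAt_metricInChart he hz a b)).hasFDerivAt
      exact h1.comp z hφ'
    have hGd := fun a b => (hGat a b).differentiableAt
    have hG : ∀ a b, pderiv k (fun w => metricInChart g e (quadraticShift C z w) a b) z =
        d k a b := fun a b => by
      simp only [pderiv, (hGat a b).fderiv, hd]
    rw [pderiv_congr hev k, pderiv_sum fun a _ => DifferentiableAt.fun_sum fun b _ =>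
      ((hJd a i).fun_mul (hJd b j)).fun_mul (hGd a b)]
    simp only [pderiv_sum fun b _ => ((hJd _ i).fun_mul (hJd b j)).fun_mul (hGd _ b),
      pderiv_mul ((hJd _ i).fun_mul (hJd _ j)) (hGd _ _), pderiv_mul (hJd _ i) (hJd _ j), hJ, hG,
      hφz, hone, sub_self, mul_zero, Finset.sum_const_zero, sub_zero]
    simp only [Matrix.one_apply, add_mul, Finset.sum_add_distrib]
    simp only [mul_ite, ite_mul, mul_one, mul_zero, one_mul, zero_mul, Finset.sum_ite_eq,
      Finset.sum_ite_eq', Finset.mem_univ, if_true]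
    simp only [hCdef, hdsymm i k j, hdsymm j k i, hdsymm k j i]
    ring

end NormalChart

/-! ### The global argument on a compact soliton. -/

section Soliton

variable {n : ℕ} {M : Type*} [TopologicalSpace M] [ChartedSpace (EuclideanSpace ℝ (Fin n)) M]
  [IsManifold (𝓡 n) ∞ M]
  {g : Bundle.ContMDiffRiemannianMetric (𝓡 n) ∞ (EuclideanSpace ℝ (Fin n))
      (fun x : M => TangentSpace (𝓡 n) x)}
  {u : M → ℝ} {lam : ℝ}

theorem IsGradientRicciSoliton.gradNormSq_le_of_isLocalMax (h : IsGradientRicciSoliton g u lam)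
    (hlam : lam ≤ 0) {ε : ℝ} (hε : 0 < ε) {p : M}
    (hmax : IsLocalMax (fun x => gradNormSq g u x - ε * u x) p) :
    gradNormSq g u p ≤ n * ε / 8 := by
  obtain ⟨e, he, z, hz, rfl, hN⟩ := exists_normal_chart (g := g) p
  rw [gradNormSq_symm he hz h.smooth]
  refine hN.gradSq_le_of_isLocalMax (contDiffAt_comp_symm he hz h.smooth) (lam := lam) ?_ hlam hε ?_
  · filter_upwards [e.open_target.mem_nhds hz] with y hy using h.equation e he y hy
  · filter_upwards [e.open_target.mem_nhds hz, (e.symm.continuousAt hz).eventually hmax]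
      with y hy h1
    rwa [gradNormSq_symm he hy h.smooth, gradNormSq_symm he hz h.smooth] at h1

/-- Comparing `|∇u|² - εu` at `x` with its maximum over `M` bounds `|∇u|²(x)` by `ε` times a
constant independent of `ε`; the minimum of `u` absorbs the unknown position of the maximum. -/
theorem IsGradientRicciSoliton.gradNormSq_nonpos [CompactSpace M]
    (h : IsGradientRicciSoliton g u lam) (hlam : lam ≤ 0) (x : M) : gradNormSq g u x ≤ 0 := by
  have hw := continuous_gradNormSq (g := g) h.smooth
  have hu : Continuous u := h.smooth.continuous
  obtain ⟨b, -, hb⟩ := isCompact_univ.exists_isMinOn ⟨x, Set.mem_univ x⟩ hu.continuousOn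
  have hbound : ∀ ε : ℝ, 0 < ε → gradNormSq g u x ≤ ε * (n / 8 + (u x - u b)) := by
    intro ε hε
    obtain ⟨p, -, hp⟩ := isCompact_univ.exists_isMaxOn ⟨x, Set.mem_univ x⟩
      (hw.sub (continuous_const.mul hu) : Continuous fun y => gradNormSq g u y - ε * u y).continuousOn
    have h1 := h.gradNormSq_le_of_isLocalMax hlam hε (hp.isLocalMax univ_mem)
    have h2 : gradNormSq g u x - ε * u x ≤ gradNormSq g u p - ε * u p := hp (Set.mem_univ x)
    have h3 : u b ≤ u p := hb (Set.mem_univ p)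
    nlinarith [mul_le_mul_of_nonneg_left h3 hε.le]
  have hlim : Tendsto (fun ε : ℝ => ε * (n / 8 + (u x - u b))) (𝓝[>] 0) (𝓝 0) := by
    have : Tendsto (fun ε : ℝ => ε * (n / 8 + (u x - u b))) (𝓝 0)
        (𝓝 (0 * (n / 8 + (u x - u b)))) := tendsto_id.mul_const _
    rw [zero_mul] at this
    exact this.mono_left nhdsWithin_le_nhds
  exact ge_of_tendsto hlim (eventually_mem_nhdsWithin.mono fun ε hε => hbound ε hε)

theorem hessian_eq_zero_of_eventually_const
    {G : EuclideanSpace ℝ (Fin n) → Matrix (Fin n) (Fin n) ℝ} {f : EuclideanSpace ℝ (Fin n) → ℝ}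
    {y : EuclideanSpace ℝ (Fin n)} {c : ℝ} (hf : f =ᶠ[𝓝 y] fun _ => c) (i j : Fin n) :
    hessian G f i j y = 0 := by
  have h1 : ∀ k, pderiv k f =ᶠ[𝓝 y] fun _ => 0 := fun k => by
    filter_upwards [pderiv_eventuallyEq hf k] with w hw
    rw [hw, pderiv_const]
  rw [hessian, pderiv_congr (h1 j) i, pderiv_const,
    Finset.sum_eq_zero fun k _ => by rw [(h1 k).self_of_nhds, mul_zero], sub_zero]

/-- The Hessian vanishes, so the Einstein constant is `lam` on every component. -/
theorem IsGradientRicciSoliton.isEinstein_of_isLocallyConstant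
    (h : IsGradientRicciSoliton g u lam) (hu : IsLocallyConstant u) : IsEinstein g := by
  refine ⟨lam, fun e he y hy i j => ?_⟩
  have h1 := h.equation e he y hy i j
  have h2 : (fun z => u (e.symm z)) =ᶠ[𝓝 y] fun _ => u (e.symm y) :=
    (e.symm.continuousAt hy).eventually (hu.eventually_eq _)
  rw [hessian_eq_zero_of_eventually_const h2] at h1
  linarith

end Soliton

end RicciSoliton

theorem proposition2p1 {n : ℕ} {M : Type*} [TopologicalSpace M] [T2Space M] [CompactSpace M]
    [ChartedSpace (EuclideanSpace ℝ (Fin n)) M] [IsManifold (𝓡 n) ∞ M]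
    (g : Bundle.ContMDiffRiemannianMetric (𝓡 n) ∞ (EuclideanSpace ℝ (Fin n))
      (fun x : M => TangentSpace (𝓡 n) x))
    (u : M → ℝ) (lam : ℝ) (hlam : lam ≤ 0)
    (h : RicciSoliton.IsGradientRicciSoliton g u lam) :
    RicciSoliton.IsEinstein g ∧ IsLocallyConstant u := by
  have hu : IsLocallyConstant u :=
    RicciSoliton.isLocallyConstant_of_gradNormSq_nonpos h.smooth (h.gradNormSq_nonpos hlam)
  exact ⟨h.isEinstein_of_isLocallyConstant hu, hu⟩
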